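/- Setting. A finite directed graph $G=(V,E)$ carries probabilities $p_e\in(0,1]$ on its edges. Each edge $e$ is live with probability $p_e$ and dead otherwise, independently. In one round of diffusion, every active node attempts to activate each inactive out-neighbour that it has not attempted before; the attempt succeeds iff the edge is live, and the states of all attempted edges are observed. A realization $\phi=(L,D)$ is a pair of disjoint subsets of $E$ (edges observed live, edges observed dead), and a status $U=(S,\phi)$ consists of a set $S\subseteq V$ of active nodes and a realization $\phi$. For a full realization $\psi$ (i.e. $L\cup D=E$), let $A_\infty(S,\psi)$ be the set of active nodes when the diffusion started from $S$ has terminated, and let $$\Delta f_\infty(S,v,\phi)=\sum_{\psi\succ\phi}\Pr[\psi\mid\phi]\,\bigl(|A_\infty(S\cup\{v\},\psi)|-|A_\infty(S,\psi)|\bigr),$$ where $\psi$ ranges over the full realizations that extend $\phi$. A policy $\pi$ maps every status to one node. Given $k\in\mathbb Z^+$ and $d\in\mathbb Z^+\cup\{\infty\}$, the $(\pi,k,d)$-process starts from the status $(\emptyset,(\emptyset,\emptyset))$ and repeats $k$ times: activate the node $\pi(U)$, where $U$ is the current status, then observe $d$ rounds of diffusion (until termination if $d=\infty$) and update the status. At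 the end one waits until the diffusion terminates; $F(\pi,k,d)$ is the expected number of active nodes. A policy $\pi_g$ is greedy if $\pi_g(S,\phi)\in\arg\max_v\Delta f_\infty(S,v,\phi)$ for every status $(S,\phi)$, with ties broken arbitrarily. For a status $U=(S,\phi)$ let $$\alpha_{\infty,\infty}(U)=\frac{\sum_{U_*=(S_*,\phi_*)}\Pr[\phi_*\mid\phi]\cdot\max_v\Delta f_\infty(S_*,v,\phi_*)}{\max_v\Delta f_\infty(S,v,\phi)},$$ where $U_*$ ranges over the possible statuses after the diffusion following $U$ has terminated, and a quotient $0/0$ is read as $0$. Let $T_g$ be the decision tree of the $(\pi_g,k,d)$-process. Its statuses are those that can be observed, with positive probability, immediately before one of the $k$ seeding steps, including the initial one. Let $\alpha(T_g)$ be the maximum of $\alpha_{\infty,\infty}(U)$ over all statuses $U$ of $T_g$. Theorem 1. For all $k\in\mathbb Z^+$ and $d\in\mathbb Z^+\cup\{\infty\}$, every greedy policy $\pi_g$ and every policy $\pi_*$, $$F(\pi_g,k,d)\;\ge\;\bigl(1-e^{-1/\alpha(T_g)}\bigr)\,F(\pi_*,k,d).$$ Moreover, if $d=\infty$ then $\alpha(T_g)=1$,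 and hence $F(\pi_g,k,\infty)\ge(1-1/e)\,F(\pi_*,k,\infty)$. -/

import Mathlib

namespace AIM

/-- An instance of the Independent Cascade model on a vertex set `V`: a directed graph with edge
set `E` and a probability `p e ∈ (0, 1]` on every edge. -/
structure ICModel (V : Type*) where
  /-- the directed edges -/
  E : Finset (V × V)
  /-- the propagation probabilities (only the values on `E` matter) -/
  p : V × V → ℝ
  p_pos : ∀ e ∈ E, 0 < p e
  p_le_one : ∀ e ∈ E, p e ≤ 1

/-- A realization: the sets of the edges that were observed to be live and to be dead. -/
@[ext]
structure Realization {V : Type*} (M : ICModel V) where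
  live : Finset (V × V)
  dead : Finset (V × V)
  live_subset : live ⊆ M.E
  dead_subset : dead ⊆ M.E
  disjoint : Disjoint live dead

/-- A status: the currently active nodes, and the realization observed so far. -/
@[ext]
structure Status {V : Type*} (M : ICModel V) where
  active : Finset V
  real : Realization M

namespace Realization

/-- The empty realization: no edge has been observed. -/
def empty {V : Type*} (M : ICModel V) : Realization M where
  live := ∅
  dead := ∅
  live_subset := Finset.empty_subset _
  dead_subset := Finset.empty_subset _
  disjoint := Finset.disjoint_empty_left _

/-- Every edge has been observed. -/
def IsFull {V : Type*} {M : ICModel V} (φ : Realization M) : Prop :=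
  ∀ e ∈ M.E, e ∈ φ.live ∨ e ∈ φ.dead

/-- `φ₁` is a sub-realization of `φ₂`. -/
def Sub {V : Type*} {M : ICModel V} (φ₁ φ₂ : Realization M) : Prop :=
  φ₁.live ⊆ φ₂.live ∧ φ₁.dead ⊆ φ₂.dead

/-- The probability that `φ` is realized. -/
def prob {V : Type*} {M : ICModel V} (φ : Realization M) : ℝ :=
  (∏ e ∈ φ.live, M.p e) * ∏ e ∈ φ.dead, (1 - M.p e)

/-- `condProb φ₂ φ₁` is the probability that `φ₂` is realized conditioned on its
sub-realization `φ₁`. -/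
def condProb {V : Type*} [DecidableEq V] {M : ICModel V} (φ₂ φ₁ : Realization M) : ℝ :=
  (∏ e ∈ φ₂.live \ φ₁.live, M.p e) * ∏ e ∈ φ₂.dead \ φ₁.dead, (1 - M.p e)

noncomputable instance {V : Type*} [Fintype V] [DecidableEq V] (M : ICModel V) :
    Fintype (Realization M) :=
  Fintype.ofInjective
    (fun φ : Realization M => ((φ.live, φ.dead) : Finset (V × V) × Finset (V × V)))
    (fun φ₁ φ₂ h => by
      have h' := Prod.mk.inj h
      exact Realization.ext h'.1 h'.2)

open scoped Classical in
/-- The full realizations that extend `φ`. -/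
noncomputable def completions {V : Type*} [Fintype V] [DecidableEq V] {M : ICModel V}
    (φ : Realization M) : Finset (Realization M) :=
  Finset.univ.filter (fun ψ => ψ.IsFull ∧ φ.Sub ψ)

/-- Add to `φ` the states, taken from `ψ`, of those edges of `X` that `φ` has not observed. -/
def observe {V : Type*} [DecidableEq V] {M : ICModel V} (φ ψ : Realization M)
    (X : Finset (V × V)) : Realization M where
  live := φ.live ∪ ψ.live.filter (fun e => e ∈ X ∧ e ∉ φ.dead)
  dead := φ.dead ∪ ψ.dead.filter (fun e => e ∈ X ∧ e ∉ φ.live)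
  live_subset := Finset.union_subset φ.live_subset
    ((Finset.filter_subset _ _).trans ψ.live_subset)
  dead_subset := Finset.union_subset φ.dead_subset
    ((Finset.filter_subset _ _).trans ψ.dead_subset)
  disjoint := by
    rw [Finset.disjoint_left]
    intro e h₁ h₂
    have hφ : e ∈ φ.live → e ∉ φ.dead := fun h => Finset.disjoint_left.mp φ.disjoint h
    have hψ : e ∈ ψ.live → e ∉ ψ.dead := fun h => Finset.disjoint_left.mp ψ.disjoint h
    simp only [Finset.mem_union, Finset.mem_filter] at h₁ h₂
    tauto

end Realization

/-- The number of rounds that are simulated for a waiting time `t ∈ {0, 1, 2, …} ∪ {∞}`; `∞`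
means to wait until the diffusion has terminated, for which `|V|` rounds are always enough
(`spread_terminated` and `round_terminated`). -/
noncomputable def rounds (V : Type*) [Fintype V] (t : ℕ∞) : ℕ :=
  if t = ⊤ then Fintype.card V else t.toNat

/-- One round of diffusion in the full realization `ψ`, followed on the active nodes only. -/
def spread {V : Type*} [Fintype V] [DecidableEq V] {M : ICModel V} (ψ : Realization M)
    (S : Finset V) : Finset V :=
  S ∪ Finset.univ.filter (fun w => ∃ u ∈ S, (u, w) ∈ ψ.live)

/-- `A_t(S, ψ)`: the active nodes in `ψ` after `t` rounds, when `S` is the set of the currently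
active nodes. -/
noncomputable def activeAfter {V : Type*} [Fintype V] [DecidableEq V] {M : ICModel V}
    (t : ℕ∞) (S : Finset V) (ψ : Realization M) : Finset V :=
  (spread ψ)^[rounds V t] S

/-- `Δ_t(S, V*, ψ)`: the marginal increase that `W = V*` brings in `ψ`. -/
noncomputable def marginal {V : Type*} [Fintype V] [DecidableEq V] {M : ICModel V}
    (t : ℕ∞) (S W : Finset V) (ψ : Realization M) : ℝ :=
  ((activeAfter t (S ∪ W) ψ).card : ℝ) - ((activeAfter t S ψ).card : ℝ)

/-- `Δf_t(S, V*, φ)`: the expected marginal profit of `W = V*` when the status is `(S, φ)`. -/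
noncomputable def expMarginal {V : Type*} [Fintype V] [DecidableEq V] {M : ICModel V}
    (t : ℕ∞) (S W : Finset V) (φ : Realization M) : ℝ :=
  ∑ ψ ∈ φ.completions, ψ.condProb φ * marginal t S W ψ

namespace Status

/-- The initial status: no active node, nothing observed. -/
def empty {V : Type*} (M : ICModel V) : Status M where
  active := ∅
  real := Realization.empty M

/-- Activate the seed node `v`. -/
def seed {V : Type*} [DecidableEq V] {M : ICModel V} (U : Status M) (v : V) : Status M where
  active := insert v U.active
  real := U.real

/-- The edges along which an active node can make an attempt in the next round: those to its
inactive out-neighbours. (Attempts that were already made are in the observed realization.) -/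
def frontier {V : Type*} [DecidableEq V] {M : ICModel V} (U : Status M) : Finset (V × V) :=
  M.E.filter (fun e => e.1 ∈ U.active ∧ e.2 ∉ U.active)

/-- One round of diffusion and observation, when the states of the edges are those of the full
realization `ψ`: every attempt is observed, and it succeeds exactly along the live edges. -/
def round {V : Type*} [Fintype V] [DecidableEq V] {M : ICModel V} (ψ : Realization M)
    (U : Status M) : Status M where
  active := U.active ∪ Finset.univ.filter
    (fun w => ∃ u ∈ U.active, (u, w) ∈ (U.real.observe ψ U.frontier).live)
  real := U.real.observe ψ U.frontier

/-- The status `d` rounds after `U` when the states of the edges are those of `ψ`. -/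
noncomputable def after {V : Type*} [Fintype V] [DecidableEq V] {M : ICModel V}
    (d : ℕ∞) (U : Status M) (ψ : Realization M) : Status M :=
  (round ψ)^[rounds V d] U

open scoped Classical in
/-- The set of the possible statuses after `d` rounds following `U` (possible: of positive
probability given `U`); for `d = ∞`, after the diffusion has terminated. -/
noncomputable def successors {V : Type*} [Fintype V] [DecidableEq V] {M : ICModel V}
    (d : ℕ∞) (U : Status M) : Finset (Status M) :=
  (U.real.completions.filter (fun ψ => 0 < ψ.condProb U.real)).image (fun ψ => U.after d ψ)

/-- The best expected marginal profit of one seed node at status `U`, without time limit. -/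
noncomputable def bestGain {V : Type*} [Fintype V] [DecidableEq V] {M : ICModel V}
    (U : Status M) : ℝ :=
  ⨆ v : V, expMarginal ⊤ U.active {v} U.real

/-- The regret ratio `α_{∞,d}(U)`. -/
noncomputable def regretRatio {V : Type*} [Fintype V] [DecidableEq V] {M : ICModel V}
    (d : ℕ∞) (U : Status M) : ℝ :=
  (∑ U' ∈ U.successors d, U'.real.condProb U.real * U'.bestGain) / U.bestGain

end Status

/-- A policy selects one seed node for every status. -/
abbrev Policy {V : Type*} (M : ICModel V) := Status M → V

namespace Policy

/-- `π` is a greedy policy: at every status it selects a node with the largest expected marginal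
profit (ties may be broken in any way). -/
def IsGreedy {V : Type*} [Fintype V] [DecidableEq V] {M : ICModel V} (π : Policy M) : Prop :=
  ∀ (U : Status M) (v : V),
    expMarginal ⊤ U.active {v} U.real ≤ expMarginal ⊤ U.active {π U} U.real

/-- The status after `i` repetitions of the two steps of the process of `π` (activate the node
that `π` selects, then observe `d` rounds), when the states of the edges are those of `ψ`. -/
noncomputable def run {V : Type*} [Fintype V] [DecidableEq V] {M : ICModel V} (π : Policy M)
    (d : ℕ∞) (ψ : Realization M) : ℕ → Status M
  | 0 => Status.empty M
  | i + 1 => ((π.run d ψ i).seed (π (π.run d ψ i))).after d ψ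

/-- `F(π, k, d)`: the expected number of active nodes that the `(π, k, d)`-process outputs, that
is after `k` seeding steps, each followed by `d` rounds, and the end of the diffusion. -/
noncomputable def profit {V : Type*} [Fintype V] [DecidableEq V] {M : ICModel V} (π : Policy M)
    (k : ℕ) (d : ℕ∞) : ℝ :=
  ∑ ψ ∈ (Realization.empty M).completions,
    ψ.prob * ((activeAfter ⊤ (π.run d ψ k).active ψ).card : ℝ)

open scoped Classical in
/-- The statuses of the tree-edges of the decision tree of `π` that enter its levels: level `0`
here is the root level, with the initial status. The tree-node at the end of the tree-edge `U` is
the seed `π U`, and the tree-edges out of it are the possible statuses `d` rounds after this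
node is activated. -/
noncomputable def treeLevel {V : Type*} [Fintype V] [DecidableEq V] {M : ICModel V}
    (π : Policy M) (d : ℕ∞) : ℕ → Finset (Status M)
  | 0 => {Status.empty M}
  | i + 1 => (π.treeLevel d i).biUnion (fun U => (U.seed (π U)).successors d)

/-- `α(T)` for the decision tree `T` of the `(π, k, d)`-process: the largest `α_{∞,∞}(U)` over
all statuses `U` of `T`. The tree has `k` levels, one for each seeding step. -/
noncomputable def treeRegret {V : Type*} [Fintype V] [DecidableEq V] {M : ICModel V}
    (π : Policy M) (k : ℕ) (d : ℕ∞) : ℝ :=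
  sSup {a : ℝ | ∃ i < k, ∃ U ∈ π.treeLevel d i, a = U.regretRatio ⊤}

end Policy

/-- After `|V|` rounds the set of the active nodes does not change any more. -/
theorem spread_terminated {V : Type*} [Fintype V] [DecidableEq V] {M : ICModel V}
    (ψ : Realization M) (S : Finset V) :
    spread ψ ((spread ψ)^[Fintype.card V] S) = (spread ψ)^[Fintype.card V] S := by
  by_contra hne
  have hsub : ∀ T : Finset V, T ⊆ spread ψ T := fun T => Finset.subset_union_left
  have key : ∀ n ≤ Fintype.card V + 1, n ≤ ((spread ψ)^[n] S).card := by
    intro n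
    induction n with
    | zero => intro _; exact Nat.zero_le _
    | succ n ih =>
      intro hn
      have h₁ := ih (by omega)
      rw [Function.iterate_succ_apply']
      have hne' : (spread ψ)^[n] S ≠ spread ψ ((spread ψ)^[n] S) := by
        intro h
        apply hne
        obtain ⟨m, hm⟩ := Nat.exists_eq_add_of_le (show n ≤ Fintype.card V by omega)
        have hfix : (spread ψ)^[Fintype.card V] S = (spread ψ)^[n] S := by
          rw [hm, Nat.add_comm, Function.iterate_add_apply]
          exact Function.iterate_fixed h.symm m
        rw [hfix]
        exact h.symm
      have := Finset.card_lt_card (lt_of_le_of_ne (hsub _) hne')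
      omega
  have h₁ := key (Fintype.card V + 1) le_rfl
  have h₂ := Finset.card_le_univ ((spread ψ)^[Fintype.card V + 1] S)
  omega

/-- A round without a newly active node is the last one in which something is observed. -/
theorem round_round_of_active_eq {V : Type*} [Fintype V] [DecidableEq V] {M : ICModel V}
    (ψ : Realization M) (U : Status M) (h : (U.round ψ).active = U.active) :
    (U.round ψ).round ψ = U.round ψ := by
  have hf : (U.round ψ).frontier = U.frontier := by
    unfold Status.frontier
    rw [h]
  have hr : (U.round ψ).real.observe ψ (U.round ψ).frontier = (U.round ψ).real := by
    rw [hf]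
    apply Realization.ext
    · apply Finset.union_eq_left.mpr
      intro e he
      simp only [Status.round, Realization.observe, Finset.mem_filter, Finset.mem_union] at he ⊢
      tauto
    · apply Finset.union_eq_left.mpr
      intro e he
      simp only [Status.round, Realization.observe, Finset.mem_filter, Finset.mem_union] at he ⊢
      tauto
  apply Status.ext
  · change (U.round ψ).active ∪ Finset.univ.filter (fun w => ∃ u ∈ (U.round ψ).active,
      (u, w) ∈ ((U.round ψ).real.observe ψ (U.round ψ).frontier).live) = (U.round ψ).active
    rw [hr, h]
    exact h
  · exact hr

/-- Nothing is observed if no node is active. -/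
theorem round_of_active_eq_empty {V : Type*} [Fintype V] [DecidableEq V] {M : ICModel V}
    (ψ : Realization M) (U : Status M) (h : U.active = ∅) : U.round ψ = U := by
  have hr : U.real.observe ψ U.frontier = U.real := by
    apply Realization.ext <;> simp [Realization.observe, Status.frontier, h]
  apply Status.ext
  · simp [Status.round, h]
  · exact hr

/-- After `|V|` rounds the status, with what has been observed, does not change any more. -/
theorem round_terminated {V : Type*} [Fintype V] [DecidableEq V] {M : ICModel V}
    (ψ : Realization M) (U : Status M) : (U.after ⊤ ψ).round ψ = U.after ⊤ ψ := by
  have hrw : U.after ⊤ ψ = (Status.round ψ)^[Fintype.card V] U := by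
    simp [Status.after, rounds]
  rw [hrw]
  by_cases h₀ : U.active = ∅
  · have hfix := round_of_active_eq_empty ψ U h₀
    rw [Function.iterate_fixed hfix, hfix]
  by_cases hstab : ∃ n < Fintype.card V, ((Status.round ψ)^[n + 1] U).active =
      ((Status.round ψ)^[n] U).active
  · obtain ⟨n, hn, h⟩ := hstab
    rw [Function.iterate_succ_apply'] at h
    have hfix := round_round_of_active_eq ψ _ h
    rw [← Function.iterate_succ_apply' (Status.round ψ) n U] at hfix
    obtain ⟨m, hm⟩ := Nat.exists_eq_add_of_le (show n + 1 ≤ Fintype.card V by omega)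
    have hV : (Status.round ψ)^[Fintype.card V] U = (Status.round ψ)^[n + 1] U := by
      rw [hm, Nat.add_comm, Function.iterate_add_apply]
      exact Function.iterate_fixed hfix m
    rw [hV, hfix]
  · exfalso
    have key : ∀ n ≤ Fintype.card V, n + 1 ≤ ((Status.round ψ)^[n] U).active.card := by
      intro n
      induction n with
      | zero =>
        intro _
        exact Finset.card_pos.mpr (Finset.nonempty_iff_ne_empty.mpr h₀)
      | succ n ih =>
        intro hn
        have h₁ := ih (by omega)
        have hne : ((Status.round ψ)^[n + 1] U).active ≠ ((Status.round ψ)^[n] U).active :=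
          fun h => hstab ⟨n, by omega, h⟩
        have hsub : ((Status.round ψ)^[n] U).active ⊆ ((Status.round ψ)^[n + 1] U).active := by
          rw [Function.iterate_succ_apply']
          exact Finset.subset_union_left
        have := Finset.card_lt_card (lt_of_le_of_ne hsub hne.symm)
        omega
    have h₁ := key (Fintype.card V) le_rfl
    have h₂ := Finset.card_le_univ ((Status.round ψ)^[Fintype.card V] U).active
    omega

end AIM

/-! Both policies are run on the same full realization. Let `U` be the status of the greedy process
after `i` repetitions, `Y` the status reached if the diffusion then terminates (`finalRun`), `b` the
best expected gain of one seed (`bestGain`), and `a i` the greedy profit for budget `i`. Then F(π*,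
k, d) ≤ a i + k · E b(Y) (`profit_le`), E b(Y) ≤ α · E b(U) (`expect_bestGain_finalRun_le`), E b(U)
≤ a (i + 1) - a i (`IsGreedy.expect_bestGain_le`). Hence each repetition shrinks the gap to F(π*, k,
d) by the factor 1 - 1/(kα), and the exponential bound follows (`one_sub_exp_mul_le_of_step`).

The first inequality carries the proof. The seeds of π* are added to `Y` one at a time. If π* is at
status `W` and selects `v`, let `Z` be the union of the active sets of `Y` and `W`. The gain of `v`
over `Z` is at most `freshReach Z v`, which depends only on edges with tail outside `Z`; the event
that `Y` and `W` are reached depends only on edges with tail in `Z`. The two are independent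
(`expect_mul`), so the conditioning can be dropped and `Z` shrunk to the active set of `Y`. That set
is closed under live edges, so fresh reach is at most the true marginal there, and a second use of
independence bounds its expectation by b(Y) (`expect_freshReach_le_bestGain`). Without termination
the closedness fails; the price of waiting is α. -/

namespace AIM

/-! ### Extension and observation of realizations -/

namespace Realization

theorem Sub.refl {V : Type*} {M : ICModel V} (φ : Realization M) : φ.Sub φ :=
  ⟨Finset.Subset.refl _, Finset.Subset.refl _⟩

theorem Sub.trans {V : Type*} {M : ICModel V} {φ₁ φ₂ φ₃ : Realization M}
    (h₁ : φ₁.Sub φ₂) (h₂ : φ₂.Sub φ₃) : φ₁.Sub φ₃ :=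
  ⟨h₁.1.trans h₂.1, h₁.2.trans h₂.2⟩

theorem empty_sub {V : Type*} {M : ICModel V} (φ : Realization M) : (empty M).Sub φ :=
  ⟨Finset.empty_subset _, Finset.empty_subset _⟩

theorem mem_completions {V : Type*} [Fintype V] [DecidableEq V] {M : ICModel V}
    {φ ψ : Realization M} : ψ ∈ φ.completions ↔ ψ.IsFull ∧ φ.Sub ψ := by
  simp [completions]

theorem mem_completions_empty {V : Type*} [Fintype V] [DecidableEq V] {M : ICModel V}
    {ψ : Realization M} : ψ ∈ (empty M).completions ↔ ψ.IsFull := by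
  simp [mem_completions, empty_sub]

theorem not_mem_dead {V : Type*} {M : ICModel V} (φ : Realization M) {e : V × V}
    (h : e ∈ φ.live) : e ∉ φ.dead := Finset.disjoint_left.mp φ.disjoint h

theorem sub_observe {V : Type*} [DecidableEq V] {M : ICModel V} (φ ψ : Realization M)
    (X : Finset (V × V)) : φ.Sub (φ.observe ψ X) :=
  ⟨Finset.subset_union_left, Finset.subset_union_left⟩

theorem observe_sub {V : Type*} [DecidableEq V] {M : ICModel V} {φ ψ : Realization M}
    (h : φ.Sub ψ) (X : Finset (V × V)) : (φ.observe ψ X).Sub ψ :=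
  ⟨Finset.union_subset h.1 (Finset.filter_subset _ _),
    Finset.union_subset h.2 (Finset.filter_subset _ _)⟩

/-- Observations that are consistent with `ψ'` would have been made in `ψ'` as well. -/
theorem observe_congr {V : Type*} [DecidableEq V] {M : ICModel V} {φ ψ ψ' : Realization M}
    {X : Finset (V × V)} (hψ : ψ.IsFull) (h : (φ.observe ψ X).Sub ψ') :
    φ.observe ψ' X = φ.observe ψ X := by
  obtain ⟨h₁, h₂⟩ := h
  have hl : ∀ e, (e ∈ φ.live ∨ e ∈ ψ.live ∧ e ∈ X ∧ e ∉ φ.dead) → e ∈ ψ'.live := fun e he =>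
    h₁ (by simpa [observe] using he)
  have hd : ∀ e, (e ∈ φ.dead ∨ e ∈ ψ.dead ∧ e ∈ X ∧ e ∉ φ.live) → e ∈ ψ'.dead := fun e he =>
    h₂ (by simpa [observe] using he)
  apply Realization.ext
  · ext e
    simp only [observe, Finset.mem_union, Finset.mem_filter]
    have a₁ := hl e
    have a₂ := hd e
    have a₃ := ψ'.not_mem_dead (e := e)
    have a₄ : e ∈ ψ'.live → e ∈ ψ.live ∨ e ∈ ψ.dead := fun h => hψ e (ψ'.live_subset h)
    tauto
  · ext e
    simp only [observe, Finset.mem_union, Finset.mem_filter]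
    have a₁ := hl e
    have a₂ := hd e
    have a₃ := ψ'.not_mem_dead (e := e)
    have a₄ : e ∈ ψ'.dead → e ∈ ψ.live ∨ e ∈ ψ.dead := fun h => hψ e (ψ'.dead_subset h)
    tauto

end Realization

/-! ### Reachability along live edges, and marginals versus fresh reach -/

/-- `T` is closed under the live edges of `ψ`. -/
def LiveClosed {V : Type*} {M : ICModel V} (ψ : Realization M) (T : Finset V) : Prop :=
  ∀ u ∈ T, ∀ w, (u, w) ∈ ψ.live → w ∈ T

section Closure

variable {V : Type*} [Fintype V] [DecidableEq V] {M : ICModel V}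

theorem subset_activeAfter (t : ℕ∞) (S : Finset V) (ψ : Realization M) :
    S ⊆ activeAfter t S ψ := by
  unfold activeAfter
  induction rounds V t with
  | zero => exact Finset.Subset.refl _
  | succ n ih =>
    rw [Function.iterate_succ_apply']
    exact ih.trans Finset.subset_union_left

theorem liveClosed_activeAfter (S : Finset V) (ψ : Realization M) :
    LiveClosed ψ (activeAfter ⊤ S ψ) := by
  intro u hu w hw
  have h := spread_terminated ψ S
  have hr : rounds V ⊤ = Fintype.card V := by simp [rounds]
  unfold activeAfter at hu ⊢
  rw [hr] at hu ⊢
  rw [← h]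
  simp only [spread, Finset.mem_union, Finset.mem_filter, Finset.mem_univ, true_and]
  exact Or.inr ⟨u, hu, hw⟩

theorem activeAfter_subset {t : ℕ∞} {S T : Finset V} {ψ : Realization M} (hST : S ⊆ T)
    (hT : LiveClosed ψ T) : activeAfter t S ψ ⊆ T := by
  unfold activeAfter
  induction rounds V t with
  | zero => exact hST
  | succ n ih =>
    rw [Function.iterate_succ_apply']
    intro w hw
    simp only [spread, Finset.mem_union, Finset.mem_filter, Finset.mem_univ, true_and] at hw
    rcases hw with hw | ⟨u, hu, hw⟩
    · exact ih hw
    · exact hT u (ih hu) w hw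

theorem activeAfter_mono {S T : Finset V} (ψ : Realization M)
    (h : S ⊆ T) : activeAfter ⊤ S ψ ⊆ activeAfter ⊤ T ψ :=
  activeAfter_subset (h.trans (subset_activeAfter _ _ _)) (liveClosed_activeAfter _ _)

theorem activeAfter_eq_self {t : ℕ∞} {S : Finset V} {ψ : Realization M} (h : LiveClosed ψ S) :
    activeAfter t S ψ = S :=
  (activeAfter_subset (Finset.Subset.refl _) h).antisymm (subset_activeAfter _ _ _)

theorem activeAfter_empty (t : ℕ∞) (ψ : Realization M) : activeAfter t ∅ ψ = ∅ :=
  activeAfter_eq_self (by simp [LiveClosed])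

theorem marginal_nonneg (S W : Finset V) (ψ : Realization M) : 0 ≤ marginal ⊤ S W ψ := by
  have := Finset.card_le_card (activeAfter_mono ψ (Finset.subset_union_left (s₁ := S) (s₂ := W)))
  unfold marginal
  have : ((activeAfter ⊤ S ψ).card : ℝ) ≤ (activeAfter ⊤ (S ∪ W) ψ).card := by exact_mod_cast this
  linarith

/-- The live edges of `ψ` whose tail is not in `Z`. -/
def Realization.avoid (ψ : Realization M) (Z : Finset V) : Realization M where
  live := ψ.live.filter (fun e => e.1 ∉ Z)
  dead := ∅
  live_subset := (Finset.filter_subset _ _).trans ψ.live_subset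
  dead_subset := Finset.empty_subset _
  disjoint := Finset.disjoint_empty_right _

/-- The number of nodes outside `Z` that `v` reaches along live edges that do not leave from
`Z`. -/
noncomputable def freshReach (Z : Finset V) (v : V) (ψ : Realization M) : ℝ :=
  ((activeAfter ⊤ {v} (ψ.avoid Z) \ Z).card : ℝ)

/-- The closure of `Z` together with the fresh nodes is closed: a live edge out of a fresh node
survives in `ψ.avoid Z`, so its head is fresh or in `Z`. `Z` need not be closed, as is required for
the status of the other policy after finitely many rounds. -/
theorem marginal_le_freshReach (Z : Finset V) (v : V) (ψ : Realization M) :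
    marginal ⊤ Z {v} ψ ≤ freshReach Z v ψ := by
  have h : activeAfter ⊤ (Z ∪ {v}) ψ ⊆
      activeAfter ⊤ Z ψ ∪ (activeAfter ⊤ {v} (ψ.avoid Z) \ Z) := by
    apply activeAfter_subset
    · intro u hu
      have h₁ := @subset_activeAfter V _ _ M ⊤ Z ψ u
      have h₂ := @subset_activeAfter V _ _ M ⊤ {v} (ψ.avoid Z) u
      simp only [Finset.mem_union, Finset.mem_sdiff] at hu ⊢
      tauto
    · intro u hu w hw
      have h₁ := liveClosed_activeAfter Z ψ u
      have h₂ := liveClosed_activeAfter {v} (ψ.avoid Z) u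
      have h₃ := @subset_activeAfter V _ _ M ⊤ Z ψ w
      simp only [Finset.mem_union, Finset.mem_sdiff] at hu ⊢
      rcases hu with hu | ⟨hu, huZ⟩
      · exact Or.inl (h₁ hu w hw)
      · have := h₂ hu w (by simp [Realization.avoid, hw, huZ])
        tauto
  have h' := (Finset.card_le_card h).trans (Finset.card_union_le _ _)
  unfold marginal freshReach
  have : ((activeAfter ⊤ (Z ∪ {v}) ψ).card : ℝ) ≤ (activeAfter ⊤ Z ψ).card +
    (activeAfter ⊤ {v} (ψ.avoid Z) \ Z).card := by exact_mod_cast h'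
  linarith

/-- Closedness of `Y` means that no node outside `Y` would become active without `v`, so every fresh
node counts as a gain. -/
theorem freshReach_le_marginal {Y : Finset V} (v : V) {ψ : Realization M}
    (hY : LiveClosed ψ Y) : freshReach Y v ψ ≤ marginal ⊤ Y {v} ψ := by
  have h : activeAfter ⊤ {v} (ψ.avoid Y) ⊆ activeAfter ⊤ (Y ∪ {v}) ψ := by
    apply activeAfter_subset
    · exact Finset.subset_union_right.trans (subset_activeAfter _ _ _)
    · intro u hu w hw
      exact liveClosed_activeAfter _ _ u hu w (Finset.mem_filter.mp hw).1
  have h' : (activeAfter ⊤ {v} (ψ.avoid Y) \ Y) ∪ Y ⊆ activeAfter ⊤ (Y ∪ {v}) ψ :=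
    Finset.union_subset (Finset.sdiff_subset.trans h)
      (Finset.subset_union_left.trans (subset_activeAfter _ _ _))
  have h'' := Finset.card_le_card h'
  rw [Finset.card_union_of_disjoint Finset.sdiff_disjoint] at h''
  unfold marginal freshReach
  rw [activeAfter_eq_self hY]
  have : ((activeAfter ⊤ {v} (ψ.avoid Y) \ Y).card : ℝ) + Y.card ≤
    (activeAfter ⊤ (Y ∪ {v}) ψ).card := by exact_mod_cast h''
  linarith

theorem freshReach_anti {Y Z : Finset V} (hYZ : Y ⊆ Z) (v : V) (ψ : Realization M) :
    freshReach Z v ψ ≤ freshReach Y v ψ := by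
  unfold freshReach
  have : activeAfter ⊤ {v} (ψ.avoid Z) ⊆ activeAfter ⊤ {v} (ψ.avoid Y) := by
    apply activeAfter_subset (subset_activeAfter _ _ _)
    intro u hu w hw
    apply liveClosed_activeAfter _ _ u hu w
    simp only [Realization.avoid, Finset.mem_filter] at hw ⊢
    exact ⟨hw.1, fun h => hw.2 (hYZ h)⟩
  exact_mod_cast Finset.card_le_card (Finset.sdiff_subset_sdiff this hYZ)

/-- This locality is one half of the independence argument; `Status.IsLocal.sub_of_agree` is the
other. -/
theorem freshReach_congr {Z : Finset V} (v : V) {ψ ψ' : Realization M}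
    (h : ∀ e, e.1 ∉ Z → (e ∈ ψ.live ↔ e ∈ ψ'.live)) :
    freshReach Z v ψ = freshReach Z v ψ' := by
  have : ψ.avoid Z = ψ'.avoid Z := by
    apply Realization.ext
    · ext e
      simp only [Realization.avoid, Finset.mem_filter]
      have := h e
      tauto
    · rfl
  rw [freshReach, this, freshReach]

end Closure

/-! ### Observed diffusion: termination, locality, and dependence on the observations only -/

section Diffusion

variable {V : Type*} [Fintype V] [DecidableEq V] {M : ICModel V}

namespace Status

theorem active_subset_round (U : Status M) (ψ : Realization M) :
    U.active ⊆ (U.round ψ).active := Finset.subset_union_left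

theorem round_congr {U : Status M} {ψ ψ' : Realization M} (hψ : ψ.IsFull)
    (h : (U.round ψ).real.Sub ψ') : U.round ψ' = U.round ψ := by
  have : U.real.observe ψ' U.frontier = U.real.observe ψ U.frontier :=
    Realization.observe_congr hψ h
  unfold round
  rw [this]

theorem sub_round_iterate (U : Status M) (ψ : Realization M) (n : ℕ) :
    U.real.Sub ((round ψ)^[n] U).real := by
  induction n with
  | zero => exact Realization.Sub.refl _
  | succ n ih =>
    rw [Function.iterate_succ_apply']
    exact ih.trans (Realization.sub_observe _ _ _)

theorem sub_after (d : ℕ∞) (U : Status M) (ψ : Realization M) : U.real.Sub (U.after d ψ).real :=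
  sub_round_iterate _ _ _

theorem after_sub (d : ℕ∞) {U : Status M} {ψ : Realization M} (h : U.real.Sub ψ) :
    (U.after d ψ).real.Sub ψ := by
  unfold after
  induction rounds V d with
  | zero => exact h
  | succ n ih =>
    rw [Function.iterate_succ_apply']
    exact Realization.observe_sub ih _

theorem active_subset_after (d : ℕ∞) (U : Status M) (ψ : Realization M) :
    U.active ⊆ (U.after d ψ).active := by
  unfold after
  induction rounds V d with
  | zero => exact Finset.Subset.refl _
  | succ n ih =>
    rw [Function.iterate_succ_apply']
    exact ih.trans (active_subset_round _ _)

/-- The status that is reached depends on the observed states of the edges only. -/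
theorem after_congr {d : ℕ∞} {U : Status M} {ψ ψ' : Realization M} (hψ : ψ.IsFull)
    (h : (U.after d ψ).real.Sub ψ') : U.after d ψ' = U.after d ψ := by
  unfold after at h ⊢
  generalize rounds V d = n at h ⊢
  induction n with
  | zero => rfl
  | succ n ih =>
    rw [Function.iterate_succ_apply'] at h
    rw [Function.iterate_succ_apply', Function.iterate_succ_apply',
      ih ((Realization.sub_observe _ _ _).trans h), round_congr hψ h]

/-- The active nodes after some rounds stay in every closed set. -/
theorem after_active_subset {d : ℕ∞} {U : Status M} {ψ : Realization M} {T : Finset V}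
    (h : U.real.Sub ψ) (hT : LiveClosed ψ T) (hU : U.active ⊆ T) : (U.after d ψ).active ⊆ T := by
  suffices ∀ n, ((round ψ)^[n] U).active ⊆ T ∧ ((round ψ)^[n] U).real.Sub ψ from (this _).1
  intro n
  induction n with
  | zero => exact ⟨hU, h⟩
  | succ n ih =>
    rw [Function.iterate_succ_apply']
    have hs := Realization.observe_sub ih.2 ((round ψ)^[n] U).frontier
    refine ⟨fun w hw => ?_, hs⟩
    simp only [round, Finset.mem_union, Finset.mem_filter, Finset.mem_univ, true_and] at hw
    rcases hw with hw | ⟨u, hu, hw⟩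
    · exact ih.1 hw
    · exact hT u (ih.1 hu) w (hs.1 hw)

/-- Nothing more happens, whatever the states of the unobserved edges are. -/
def IsTerminated (U : Status M) : Prop := ∀ ψ : Realization M, U.real.Sub ψ → U.round ψ = U

theorem isTerminated_after (U : Status M) {ψ : Realization M} (hψ : ψ.IsFull) :
    (U.after ⊤ ψ).IsTerminated := by
  intro ψ' h'
  have := round_terminated ψ U
  -- The last round under `ψ` observes nothing new, so any `ψ'` consistent with the status is
  -- consistent with that round too.
  rw [round_congr hψ (by rwa [this]), this]

theorem isTerminated_empty : (Status.empty M).IsTerminated :=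
  fun ψ _ => round_of_active_eq_empty ψ _ rfl

theorem IsTerminated.after_eq {U : Status M} (hU : U.IsTerminated) {ψ : Realization M}
    (h : U.real.Sub ψ) (d : ℕ∞) : U.after d ψ = U :=
  Function.iterate_fixed (hU ψ h) _

/-- A live edge from an active to an inactive node would be attempted in one more round and activate
its head. -/
theorem IsTerminated.liveClosed {U : Status M} (hU : U.IsTerminated) {ψ : Realization M}
    (h : U.real.Sub ψ) : LiveClosed ψ U.active := by
  intro u hu w hw
  by_contra hwU
  have hmem : w ∈ (U.round ψ).active := by
    simp only [round, Finset.mem_union, Finset.mem_filter, Finset.mem_univ, true_and]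
    refine Or.inr ⟨u, hu, ?_⟩
    simp only [Realization.observe, frontier, Finset.mem_union, Finset.mem_filter]
    exact Or.inr ⟨hw, ⟨ψ.live_subset hw, hu, hwU⟩, fun hd => ψ.not_mem_dead hw (h.2 hd)⟩
  rw [hU ψ h] at hmem
  exact hwU hmem

/-- All the observed edges leave from active nodes. -/
def IsLocal {W : Type*} {N : ICModel W} (U : Status N) : Prop :=
  ∀ e, e ∈ U.real.live ∨ e ∈ U.real.dead → e.1 ∈ U.active

theorem IsLocal.seed {W : Type*} [DecidableEq W] {N : ICModel W} {U : Status N}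
    (hU : U.IsLocal) (v : W) :
    (U.seed v).IsLocal :=
  fun e he => Finset.mem_insert_of_mem (hU e he)

theorem IsLocal.round {U : Status M} (hU : U.IsLocal) (ψ : Realization M) :
    (U.round ψ).IsLocal := by
  intro e he
  apply active_subset_round
  have := hU e
  simp only [Status.round, Realization.observe, frontier, Finset.mem_union,
    Finset.mem_filter] at he
  tauto

theorem IsLocal.after {U : Status M} (hU : U.IsLocal) (d : ℕ∞) (ψ : Realization M) :
    (U.after d ψ).IsLocal := by
  unfold Status.after
  induction rounds V d with
  | zero => exact hU
  | succ n ih =>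
    rw [Function.iterate_succ_apply']
    exact ih.round ψ

/-- Makes consistency with a local status an event that depends only on edges with tail in `Z`.
Comparing live edges suffices, because in a full realization an edge that is not live is dead. -/
theorem IsLocal.sub_of_agree {W : Type*} {N : ICModel W} {U : Status N} (hU : U.IsLocal)
    {ψ ψ' : Realization N} (hψ' : ψ'.IsFull) (h : U.real.Sub ψ) {Z : Finset W} (hZ : U.active ⊆ Z)
    (hag : ∀ e, e.1 ∈ Z → (e ∈ ψ.live ↔ e ∈ ψ'.live)) : U.real.Sub ψ' := by
  refine ⟨fun e he => (hag e (hZ (hU e (Or.inl he)))).mp (h.1 he), fun e he => ?_⟩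
  rcases hψ' e (U.real.dead_subset he) with hl | hd
  · exact absurd (h.2 he) (ψ.not_mem_dead ((hag e (hZ (hU e (Or.inr he)))).mpr hl))
  · exact hd

end Status

namespace Policy

variable (π : Policy M) (d : ℕ∞)

theorem run_sub (ψ : Realization M) (i : ℕ) : (π.run d ψ i).real.Sub ψ := by
  induction i with
  | zero => exact Realization.empty_sub ψ
  | succ i ih => exact Status.after_sub d (U := (π.run d ψ i).seed _) ih

theorem run_isLocal (ψ : Realization M) (i : ℕ) : (π.run d ψ i).IsLocal := by
  induction i with
  | zero =>
    intro e he
    simp [run, Status.empty, Realization.empty] at he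
  | succ i ih => exact (ih.seed _).after d ψ

/-- By induction the seeds chosen agree, since they are functions of the status. Hence reaching a
given status is the same event as realizing its observations (`run_eq_iff`). -/
theorem run_congr {ψ ψ' : Realization M} (hψ : ψ.IsFull) {i : ℕ}
    (h : (π.run d ψ i).real.Sub ψ') : π.run d ψ' i = π.run d ψ i := by
  induction i with
  | zero => rfl
  | succ i ih =>
    have h₁ : (π.run d ψ i).real.Sub ψ' :=
      Realization.Sub.trans (Status.sub_after d ((π.run d ψ i).seed _) ψ) h
    simp only [run] at h ⊢
    rw [ih h₁, Status.after_congr hψ h]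

theorem insert_run_subset (ψ : Realization M) (i : ℕ) :
    (π.run d ψ i).active ∪ {π (π.run d ψ i)} ⊆ (π.run d ψ (i + 1)).active := by
  refine Finset.Subset.trans ?_ (Status.active_subset_after d _ ψ)
  intro u hu
  simp only [Status.seed, Finset.mem_insert, Finset.mem_union, Finset.mem_singleton] at hu ⊢
  tauto

end Policy

end Diffusion

/-! ### The product measure on realizations, independence and conditioning -/

section Probability

variable {V : Type*} [DecidableEq V] {M : ICModel V}

namespace Realization

theorem prob_nonneg {W : Type*} {N : ICModel W} (φ : Realization N) : 0 ≤ φ.prob :=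
  mul_nonneg (Finset.prod_nonneg fun e he => (N.p_pos e (φ.live_subset he)).le)
    (Finset.prod_nonneg fun e he => sub_nonneg.mpr (N.p_le_one e (φ.dead_subset he)))

theorem condProb_nonneg {W : Type*} [DecidableEq W] {N : ICModel W} (ψ φ : Realization N) :
    0 ≤ ψ.condProb φ :=
  mul_nonneg
    (Finset.prod_nonneg fun e he =>
      (N.p_pos e (ψ.live_subset (Finset.mem_sdiff.mp he).1)).le)
    (Finset.prod_nonneg fun e he =>
      sub_nonneg.mpr (N.p_le_one e (ψ.dead_subset (Finset.mem_sdiff.mp he).1)))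

theorem condProb_self {W : Type*} [DecidableEq W] {N : ICModel W} (φ : Realization N) :
    φ.condProb φ = 1 := by
  simp [condProb]

theorem prob_mul_condProb {W : Type*} [DecidableEq W] {N : ICModel W} {φ ψ : Realization N}
    (h : φ.Sub ψ) : φ.prob * ψ.condProb φ = ψ.prob := by
  unfold prob condProb
  rw [← Finset.prod_sdiff h.1, ← Finset.prod_sdiff h.2]
  ring

theorem condProb_mul_condProb {W : Type*} [DecidableEq W] {N : ICModel W}
    {φ₁ φ₂ φ₃ : Realization N} (h₁ : φ₁.Sub φ₂) (h₂ : φ₂.Sub φ₃) :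
    φ₂.condProb φ₁ * φ₃.condProb φ₂ = φ₃.condProb φ₁ := by
  have hd : ∀ {A B C : Finset (W × W)}, A ⊆ B → B ⊆ C → ∀ f : W × W → ℝ,
      (∏ e ∈ B \ A, f e) * ∏ e ∈ C \ B, f e = ∏ e ∈ C \ A, f e := by
    intro A B C hAB hBC f
    rw [← Finset.prod_sdiff (Finset.sdiff_subset_sdiff hBC (Finset.Subset.refl A)),
      Finset.sdiff_sdiff_left', mul_comm]
    congr 2
    ext e
    have := @hAB e
    simp only [Finset.mem_sdiff, Finset.mem_inter]
    tauto
  unfold condProb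
  rw [← hd h₁.1 h₂.1, ← hd h₁.2 h₂.2]
  ring

theorem IsFull.dead_eq {ψ : Realization M} (h : ψ.IsFull) : ψ.dead = M.E \ ψ.live := by
  ext e
  have h₁ := h e
  have h₂ := @ψ.dead_subset e
  have h₃ := ψ.not_mem_dead (e := e)
  simp only [Finset.mem_sdiff]
  tauto

/-- The completion of `φ` in which exactly the edges of `T` are live among the unobserved ones. -/
def complete (φ : Realization M) (T : Finset (V × V)) (hT : T ⊆ M.E \ (φ.live ∪ φ.dead)) :
    Realization M where
  live := φ.live ∪ T
  dead := M.E \ (φ.live ∪ T)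
  live_subset := Finset.union_subset φ.live_subset (hT.trans Finset.sdiff_subset)
  dead_subset := Finset.sdiff_subset
  disjoint := Finset.disjoint_sdiff

/-- Expand the product of `p e + (1 - p e) = 1` over the unobserved edges; each subset `T` of them,
taken as live, gives one completion. -/
theorem sum_condProb [Fintype V] (φ : Realization M) : ∑ ψ ∈ φ.completions, ψ.condProb φ = 1 := by
  have h := Finset.prod_add M.p (fun e => 1 - M.p e) (M.E \ (φ.live ∪ φ.dead))
  simp only [add_sub_cancel, Finset.prod_const_one] at h
  rw [h]
  refine Finset.sum_bij' (fun ψ _ => ψ.live \ φ.live)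
    (fun T hT => φ.complete T (Finset.mem_powerset.mp hT)) ?_ ?_ ?_ ?_ ?_
  · intro ψ hψ
    obtain ⟨hf, h₁, h₂⟩ := mem_completions.mp hψ
    rw [Finset.mem_powerset]
    intro e he
    have h₁ := @ψ.live_subset e
    have h₃ := ψ.not_mem_dead (e := e)
    have h₄ := @h₂ e
    simp only [Finset.mem_sdiff, Finset.mem_union] at he ⊢
    tauto
  · intro T hT
    rw [mem_completions]
    refine ⟨fun e he => ?_, Finset.subset_union_left, fun e he => ?_⟩
    · simp only [complete, Finset.mem_sdiff]
      tauto
    · have h₁ := φ.dead_subset he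
      have h₂ := φ.not_mem_dead (e := e)
      have h₃ : e ∈ T → _ := fun h => Finset.mem_powerset.mp hT h
      simp only [complete, Finset.mem_sdiff, Finset.mem_union] at h₃ ⊢
      tauto
  · intro ψ hψ
    obtain ⟨hf, h₁, h₂⟩ := mem_completions.mp hψ
    have hl : φ.live ∪ ψ.live \ φ.live = ψ.live := Finset.union_sdiff_of_subset h₁
    apply Realization.ext
    · exact hl
    · simp only [complete, hl, hf.dead_eq]
  · intro T hT
    simp only [complete]
    rw [Finset.union_sdiff_cancel_left]
    rw [Finset.disjoint_left]
    intro e he heT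
    have h₃ := Finset.mem_powerset.mp hT heT
    simp only [Finset.mem_sdiff, Finset.mem_union] at h₃
    tauto
  · intro ψ hψ
    obtain ⟨hf, h₁, h₂⟩ := mem_completions.mp hψ
    unfold condProb
    congr 2
    rw [hf.dead_eq]
    ext e
    have h₁ := @h₁ e
    simp only [Finset.mem_sdiff, Finset.mem_union]
    tauto

/-- The realization that takes the states of the edges of `B` from `ψ` and those of the other
edges from `ψ'`. -/
def mix (B : Finset (V × V)) (ψ ψ' : Realization M) : Realization M where
  live := ψ.live.filter (· ∈ B) ∪ ψ'.live.filter (· ∉ B)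
  dead := ψ.dead.filter (· ∈ B) ∪ ψ'.dead.filter (· ∉ B)
  live_subset := Finset.union_subset ((Finset.filter_subset _ _).trans ψ.live_subset)
    ((Finset.filter_subset _ _).trans ψ'.live_subset)
  dead_subset := Finset.union_subset ((Finset.filter_subset _ _).trans ψ.dead_subset)
    ((Finset.filter_subset _ _).trans ψ'.dead_subset)
  disjoint := by
    rw [Finset.disjoint_left]
    intro e h₁ h₂
    have a₁ := ψ.not_mem_dead (e := e)
    have a₂ := ψ'.not_mem_dead (e := e)
    simp only [Finset.mem_union, Finset.mem_filter] at h₁ h₂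
    tauto

theorem IsFull.mix {ψ ψ' : Realization M} (h : ψ.IsFull) (h' : ψ'.IsFull)
    (B : Finset (V × V)) : (mix B ψ ψ').IsFull := by
  intro e he
  have h₁ := h e he
  have h₂ := h' e he
  simp only [Realization.mix, Finset.mem_union, Finset.mem_filter]
  tauto

theorem mix_mix (B : Finset (V × V)) (ψ ψ' : Realization M) :
    mix B (mix B ψ ψ') (mix B ψ' ψ) = ψ := by
  apply Realization.ext
  · ext e
    simp only [mix, Finset.mem_union, Finset.mem_filter]
    tauto
  · ext e
    simp only [mix, Finset.mem_union, Finset.mem_filter]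
    tauto

theorem prob_mix_mul_prob_mix (B : Finset (V × V)) (ψ ψ' : Realization M) :
    (mix B ψ ψ').prob * (mix B ψ' ψ).prob = ψ.prob * ψ'.prob := by
  have h₁ : ∀ (A C : Finset (V × V)) (f : V × V → ℝ),
      ∏ e ∈ A.filter (· ∈ B) ∪ C.filter (· ∉ B), f e =
        (∏ e ∈ A with e ∈ B, f e) * ∏ e ∈ C with e ∉ B, f e := fun A C f =>
    Finset.prod_union (Finset.disjoint_left.mpr fun e h h' =>
      (Finset.mem_filter.mp h').2 (Finset.mem_filter.mp h).2)
  have h₂ : ∀ (A : Finset (V × V)) (f : V × V → ℝ),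
      ∏ e ∈ A, f e = (∏ e ∈ A with e ∈ B, f e) * ∏ e ∈ A with e ∉ B, f e := fun A f =>
    (Finset.prod_filter_mul_prod_filter_not A (· ∈ B) f).symm
  unfold prob
  simp only [mix]
  rw [h₁, h₁, h₁, h₁, h₂ ψ.live, h₂ ψ.dead, h₂ ψ'.live, h₂ ψ'.dead]
  ring

end Realization

open Realization

theorem condProb_empty (ψ : Realization M) : ψ.condProb (Realization.empty M) = ψ.prob := by
  simp [condProb, prob, Realization.empty]

variable [Fintype V]

/-- The expectation of `f` when every edge is live with its own probability, independently. -/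
noncomputable def expect (f : Realization M → ℝ) : ℝ :=
  ∑ ψ ∈ (Realization.empty M).completions, ψ.prob * f ψ

theorem expect_one : expect (fun _ : Realization M => (1 : ℝ)) = 1 := by
  simpa [expect, condProb_empty] using sum_condProb (Realization.empty M)

theorem expect_mono {f g : Realization M → ℝ}
    (h : ∀ ψ, ψ.IsFull → 0 < ψ.prob → f ψ ≤ g ψ) : expect f ≤ expect g := by
  apply Finset.sum_le_sum
  intro ψ hψ
  rcases (prob_nonneg ψ).eq_or_lt with h₀ | h₀
  · simp [← h₀]
  · exact mul_le_mul_of_nonneg_left (h ψ (mem_completions_empty.mp hψ) h₀) h₀.le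

theorem expect_add (f g : Realization M → ℝ) :
    expect (fun ψ => f ψ + g ψ) = expect f + expect g := by
  simp [expect, mul_add, Finset.sum_add_distrib]

theorem expect_const_mul (c : ℝ) (f : Realization M → ℝ) :
    expect (fun ψ => c * f ψ) = c * expect f := by
  simp only [expect, Finset.mul_sum]
  exact Finset.sum_congr rfl fun ψ _ => by ring

theorem expect_nonneg {f : Realization M → ℝ} (h : ∀ ψ, 0 ≤ f ψ) : 0 ≤ expect f :=
  Finset.sum_nonneg fun ψ _ => mul_nonneg (prob_nonneg ψ) (h ψ)

/-- Functions of disjoint sets of edges are independent. -/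
theorem expect_mul (B : Finset (V × V)) {f g : Realization M → ℝ}
    (hf : ∀ ψ ψ' : Realization M, ψ.IsFull → ψ'.IsFull →
      (∀ e ∈ B, e ∈ ψ.live ↔ e ∈ ψ'.live) → f ψ = f ψ')
    (hg : ∀ ψ ψ' : Realization M, ψ.IsFull → ψ'.IsFull →
      (∀ e ∉ B, e ∈ ψ.live ↔ e ∈ ψ'.live) → g ψ = g ψ') :
    expect (fun ψ => f ψ * g ψ) = expect f * expect g := by
  have key : expect f * expect g =
      expect (fun ψ => f ψ * g ψ) * expect (fun _ : Realization M => (1 : ℝ)) := by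
    unfold expect
    rw [Finset.sum_mul_sum, Finset.sum_mul_sum, ← Finset.sum_product', ← Finset.sum_product']
    -- The involution that exchanges two independent copies outside `B` preserves their joint weight
    -- and turns `f q.1 * g q.2` into `f * g` evaluated at a single copy.
    refine Finset.sum_nbij' (fun q => (mix B q.1 q.2, mix B q.2 q.1))
      (fun q => (mix B q.1 q.2, mix B q.2 q.1)) ?_ ?_ ?_ ?_ ?_
    · intro q hq
      simp only [Finset.mem_product, mem_completions_empty] at hq ⊢
      exact ⟨hq.1.mix hq.2 B, hq.2.mix hq.1 B⟩
    · intro q hq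
      simp only [Finset.mem_product, mem_completions_empty] at hq ⊢
      exact ⟨hq.1.mix hq.2 B, hq.2.mix hq.1 B⟩
    · intro q _
      simp only [mix_mix]
    · intro q _
      simp only [mix_mix]
    · intro q hq
      simp only [Finset.mem_product, mem_completions_empty] at hq
      have h₁ : f (mix B q.1 q.2) = f q.1 := by
        apply hf _ _ (hq.1.mix hq.2 B) hq.1
        intro e he
        simp [mix, he]
      have h₂ : g (mix B q.1 q.2) = g q.2 := by
        apply hg _ _ (hq.1.mix hq.2 B) hq.2
        intro e he
        simp [mix, he]
      simp only [h₁, h₂]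
      linear_combination -(f q.1 * g q.2) * prob_mix_mul_prob_mix B q.1 q.2
  rw [key, expect_one, mul_one]

open scoped Classical in
/-- An inequality of expectations can be checked on the fibres of a function. -/
theorem expect_le_of_fiber {β : Type*} (key : Realization M → β) {f g : Realization M → ℝ}
    (h : ∀ ψ₀ : Realization M, ψ₀.IsFull → 0 < ψ₀.prob →
      ∃ P : Realization M → Prop, (∀ ψ, key ψ = key ψ₀ ↔ P ψ) ∧
        expect (fun ψ => (if P ψ then 1 else 0) * f ψ) ≤
          expect (fun ψ => (if P ψ then 1 else 0) * g ψ)) :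
    expect f ≤ expect g := by
  -- Realizations of probability zero contribute nothing; every other one lies in exactly one of the
  -- listed fibres.
  have split : ∀ f : Realization M → ℝ, expect f =
      ∑ b ∈ ((Realization.empty M).completions.filter (fun ψ => 0 < ψ.prob)).image key,
        expect (fun ψ => (if key ψ = b then 1 else 0) * f ψ) := by
    intro f
    unfold expect
    rw [Finset.sum_comm]
    refine Finset.sum_congr rfl fun ψ hψ => ?_
    rcases (prob_nonneg ψ).eq_or_lt with h₀ | h₀
    · simp [← h₀]
    · have hmem : key ψ ∈
          ((Realization.empty M).completions.filter (fun ψ => 0 < ψ.prob)).image key :=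
        Finset.mem_image_of_mem _ (Finset.mem_filter.mpr ⟨hψ, h₀⟩)
      rw [Finset.sum_eq_single_of_mem _ hmem]
      · simp
      · intro b _ hb
        simp [hb.symm]
  rw [split f, split g]
  apply Finset.sum_le_sum
  intro b hb
  obtain ⟨ψ₀, hψ₀, rfl⟩ := Finset.mem_image.mp hb
  rw [Finset.mem_filter, mem_completions_empty] at hψ₀
  obtain ⟨P, hP, hle⟩ := h ψ₀ hψ₀.1 hψ₀.2
  obtain rfl : (fun ψ => key ψ = key ψ₀) = P := funext fun ψ => propext (hP ψ)
  exact hle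

open scoped Classical in
/-- The expectation over the event that `φ` is realized. -/
theorem expect_ite_sub (φ : Realization M) (f : Realization M → ℝ) :
    expect (fun ψ => (if φ.Sub ψ then 1 else 0) * f ψ) =
      φ.prob * ∑ ψ ∈ φ.completions, ψ.condProb φ * f ψ := by
  have h : φ.completions = (Realization.empty M).completions.filter (fun ψ => φ.Sub ψ) := by
    ext ψ
    simp [mem_completions, empty_sub]
  unfold expect
  rw [h, Finset.mul_sum, Finset.sum_filter]
  refine Finset.sum_congr rfl fun ψ _ => ?_
  by_cases hs : φ.Sub ψ
  · simp only [if_pos hs]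
    rw [← prob_mul_condProb hs]
    ring
  · simp [hs]

theorem prob_pos_of_sub {W : Type*} [DecidableEq W] {N : ICModel W} {φ ψ : Realization N}
    (h : φ.Sub ψ) (hψ : 0 < ψ.prob) : 0 < φ.prob := by
  rw [← prob_mul_condProb h] at hψ
  exact pos_of_mul_pos_left hψ (condProb_nonneg _ _)

theorem condProb_pos_of_sub {W : Type*} [DecidableEq W] {N : ICModel W} {φ ψ : Realization N}
    (h : φ.Sub ψ) (hψ : 0 < ψ.prob) : 0 < ψ.condProb φ := by
  rw [← prob_mul_condProb h] at hψ
  exact pos_of_mul_pos_right hψ (prob_nonneg _)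

end Probability

open Realization

/-! ### Best gains, successor statuses and the regret ratio -/

section Adaptive

variable {V : Type*} [Fintype V] [DecidableEq V] {M : ICModel V}

namespace Status

theorem expMarginal_le_bestGain (U : Status M) (v : V) :
    expMarginal ⊤ U.active {v} U.real ≤ U.bestGain :=
  le_ciSup (f := fun v => expMarginal ⊤ U.active {v} U.real) (Set.finite_range _).bddAbove v

theorem bestGain_nonneg (U : Status M) : 0 ≤ U.bestGain :=
  Real.iSup_nonneg fun _ =>
    Finset.sum_nonneg fun _ _ => mul_nonneg (condProb_nonneg _ _) (marginal_nonneg _ _ _)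

/-- Nodes outside of a terminated status are reached along unobserved edges only. -/
theorem expect_freshReach_le_bestGain {U : Status M} (hU : U.IsTerminated) (hl : U.IsLocal)
    (hp : 0 < U.real.prob) (v : V) : expect (freshReach (M := M) U.active v) ≤ U.bestGain := by
  classical
  refine le_trans ?_ (U.expMarginal_le_bestGain v)
  -- By locality the event looks only at tails in `U.active`, fresh reach only at the other tails.
  have hind : expect (fun ψ => (if U.real.Sub ψ then 1 else 0) * freshReach U.active v ψ) =
      expect (fun ψ => if U.real.Sub ψ then 1 else 0) * expect (freshReach (M := M) U.active v) := by
    apply expect_mul (Finset.univ.filter (fun e => e.1 ∈ U.active))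
    · intro ψ ψ' hψ hψ' h
      have h' : ∀ e : V × V, e.1 ∈ U.active → (e ∈ ψ.live ↔ e ∈ ψ'.live) := fun e he =>
        h e (by simpa using he)
      have : U.real.Sub ψ ↔ U.real.Sub ψ' :=
        ⟨fun hs => hl.sub_of_agree hψ' hs (Finset.Subset.refl _) h',
          fun hs => hl.sub_of_agree hψ hs (Finset.Subset.refl _) fun e he => (h' e he).symm⟩
      simp only [this]
    · intro ψ ψ' _ _ h
      exact freshReach_congr v fun e he => h e (by simpa using he)
  have hone : expect (fun ψ : Realization M => if U.real.Sub ψ then (1 : ℝ) else 0) =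
      U.real.prob := by
    have := expect_ite_sub U.real (fun _ => 1)
    simpa [sum_condProb] using this
  have hle : expect (fun ψ => (if U.real.Sub ψ then 1 else 0) * freshReach U.active v ψ) ≤
      expect (fun ψ => (if U.real.Sub ψ then 1 else 0) * marginal ⊤ U.active {v} ψ) := by
    apply expect_mono
    intro ψ _ _
    split_ifs with hs
    · simpa using freshReach_le_marginal v (hU.liveClosed hs)
    · simp
  rw [hind, hone, expect_ite_sub] at hle
  exact le_of_mul_le_mul_left hle hp

/-- Waiting activates only nodes that `U` would reach anyway, so neither closure gets larger, and
the one without `W` does not get smaller. -/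
theorem marginal_after_le (d : ℕ∞) {U : Status M} {ψ : Realization M} (h : U.real.Sub ψ)
    (W : Finset V) : marginal ⊤ (U.after d ψ).active W ψ ≤ marginal ⊤ U.active W ψ := by
  have h₁ : activeAfter ⊤ ((U.after d ψ).active ∪ W) ψ ⊆ activeAfter ⊤ (U.active ∪ W) ψ := by
    apply activeAfter_subset _ (liveClosed_activeAfter _ _)
    refine Finset.union_subset ?_
      (Finset.subset_union_right.trans (subset_activeAfter _ _ _))
    exact after_active_subset h (liveClosed_activeAfter _ _)
      (Finset.subset_union_left.trans (subset_activeAfter _ _ _))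
  have h₂ := activeAfter_mono ψ (active_subset_after d U ψ)
  have h₁' : ((activeAfter ⊤ ((U.after d ψ).active ∪ W) ψ).card : ℝ) ≤
    (activeAfter ⊤ (U.active ∪ W) ψ).card := by exact_mod_cast Finset.card_le_card h₁
  have h₂' : ((activeAfter ⊤ U.active ψ).card : ℝ) ≤
    (activeAfter ⊤ (U.after d ψ).active ψ).card := by exact_mod_cast Finset.card_le_card h₂
  unfold marginal
  linarith

theorem mem_successors {d : ℕ∞} {U U' : Status M} : U' ∈ U.successors d ↔
    ∃ ψ : Realization M, ψ.IsFull ∧ U.real.Sub ψ ∧ 0 < ψ.condProb U.real ∧ U.after d ψ = U' := by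
  simp [successors, mem_completions, and_assoc]

/-- The expectation of a function of the status after `d` rounds. -/
theorem sum_successors (d : ℕ∞) (U : Status M) (G : Status M → ℝ) :
    ∑ U' ∈ U.successors d, U'.real.condProb U.real * G U' =
      ∑ ψ ∈ U.real.completions, ψ.condProb U.real * G (U.after d ψ) := by
  classical
  have hpos : ∑ ψ ∈ U.real.completions, ψ.condProb U.real * G (U.after d ψ) =
      ∑ ψ ∈ U.real.completions with 0 < ψ.condProb U.real,
        ψ.condProb U.real * G (U.after d ψ) := by
    symm
    apply Finset.sum_filter_of_ne
    intro ψ _ hne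
    exact (condProb_nonneg _ _).lt_of_ne fun h => hne (by simp [← h])
  rw [hpos, ← Finset.sum_fiberwise_of_maps_to (t := U.successors d) (g := fun ψ => U.after d ψ)]
  · refine Finset.sum_congr rfl fun U' hU' => ?_
    -- The fibre over a successor consists of the completions of its realization with positive
    -- weight; the chain rule sums their weights to the weight of the successor.
    obtain ⟨ψ₀, hf₀, hs₀, -, rfl⟩ := mem_successors.mp hU'
    have h₁ : ∀ ψ ∈ (U.after d ψ₀).real.completions,
        (U.after d ψ₀).real.condProb U.real * ψ.condProb (U.after d ψ₀).real =
          ψ.condProb U.real := fun ψ hψ =>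
      condProb_mul_condProb (sub_after d U ψ₀) (mem_completions.mp hψ).2
    calc (U.after d ψ₀).real.condProb U.real * G (U.after d ψ₀)
        = ∑ ψ ∈ (U.after d ψ₀).real.completions, ψ.condProb U.real * G (U.after d ψ₀) := by
          rw [← Finset.sum_mul, ← Finset.sum_congr rfl h₁, ← Finset.mul_sum, sum_condProb,
            mul_one]
      _ = ∑ ψ ∈ (U.after d ψ₀).real.completions, ψ.condProb U.real * G (U.after d ψ) := by
          refine Finset.sum_congr rfl fun ψ hψ => ?_
          rw [after_congr hf₀ (mem_completions.mp hψ).2]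
      _ = _ := by
          symm
          apply Finset.sum_subset
          · intro ψ hψ
            simp only [Finset.mem_filter, mem_completions] at hψ ⊢
            exact ⟨hψ.1.1.1, hψ.2 ▸ after_sub d hψ.1.1.2⟩
          · intro ψ hψ hn
            obtain ⟨hf, hs⟩ := mem_completions.mp hψ
            simp only [Finset.mem_filter, mem_completions, not_and] at hn
            by_contra hne
            refine hn ⟨⟨hf, (sub_after d U ψ₀).trans hs⟩, ?_⟩ (after_congr hf₀ hs)
            exact (condProb_nonneg _ _).lt_of_ne fun h => hne (by simp [← h])
  · intro ψ hψ
    rw [Finset.mem_filter, mem_completions] at hψ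
    exact mem_successors.mpr ⟨ψ, hψ.1.1, hψ.1.2, hψ.2, rfl⟩

/-- For the best `v` at `U'`, the weighted gain is dominated by the part of the gain of `v` at `U`
that comes from completions of `U'`. This serves the degenerate case `U.bestGain = 0` of the regret
ratio. -/
theorem condProb_mul_bestGain_le [Nonempty V] {d : ℕ∞} {U U' : Status M}
    (h : U' ∈ U.successors d) : U'.real.condProb U.real * U'.bestGain ≤ U.bestGain := by
  obtain ⟨ψ₀, hf₀, hs₀, -, rfl⟩ := mem_successors.mp h
  obtain ⟨v, hv⟩ := exists_eq_ciSup_of_finite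
    (f := fun v => expMarginal ⊤ (U.after d ψ₀).active {v} (U.after d ψ₀).real)
  refine le_trans ?_ (U.expMarginal_le_bestGain v)
  unfold bestGain
  rw [← hv, expMarginal, expMarginal, Finset.mul_sum]
  calc _ ≤ ∑ ψ ∈ (U.after d ψ₀).real.completions,
        ψ.condProb U.real * marginal ⊤ U.active {v} ψ := by
        refine Finset.sum_le_sum fun ψ hψ => ?_
        have hs := (mem_completions.mp hψ).2
        rw [← mul_assoc, condProb_mul_condProb (sub_after d U ψ₀) hs]
        refine mul_le_mul_of_nonneg_left ?_ (condProb_nonneg _ _)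
        have := marginal_after_le d ((sub_after d U ψ₀).trans hs) {v}
        rwa [after_congr hf₀ hs] at this
    _ ≤ _ := by
        apply Finset.sum_le_sum_of_subset_of_nonneg
        · intro ψ hψ
          rw [mem_completions] at hψ ⊢
          exact ⟨hψ.1, (sub_after d U ψ₀).trans hψ.2⟩
        · intro ψ _ _
          exact mul_nonneg (condProb_nonneg _ _) (marginal_nonneg _ _ _)

/-- Clearing the denominator is harmless under the convention 0/0 = 0: if the best gain at `U` is
zero, so is each term of the numerator. -/
theorem sum_bestGain_le [Nonempty V] (d : ℕ∞) (U : Status M) :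
    ∑ U' ∈ U.successors d, U'.real.condProb U.real * U'.bestGain ≤
      U.regretRatio d * U.bestGain := by
  by_cases h : U.bestGain = 0
  · rw [h, mul_zero]
    exact Finset.sum_nonpos fun U' hU' => (condProb_mul_bestGain_le hU').trans h.le
  · rw [regretRatio, div_mul_cancel₀ _ h]

theorem IsTerminated.successors_eq {U : Status M} (hU : U.IsTerminated) (d : ℕ∞) :
    U.successors d = {U} := by
  obtain ⟨ψ₀, hψ₀, hpos⟩ : ∃ ψ ∈ U.real.completions, 0 < ψ.condProb U.real := by
    by_contra! h
    have := Finset.sum_nonpos h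
    rw [sum_condProb] at this
    linarith
  obtain ⟨hf₀, hs₀⟩ := mem_completions.mp hψ₀
  ext U'
  rw [mem_successors, Finset.mem_singleton]
  constructor
  · rintro ⟨ψ, -, hs, -, rfl⟩
    exact hU.after_eq hs d
  · rintro rfl
    exact ⟨ψ₀, hf₀, hs₀, hpos, hU.after_eq hs₀ d⟩

theorem IsTerminated.regretRatio_eq {U : Status M} (hU : U.IsTerminated) (d : ℕ∞) :
    U.regretRatio d = U.bestGain / U.bestGain := by
  rw [regretRatio, hU.successors_eq, Finset.sum_singleton, condProb_self, one_mul]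

/-- Any seed gains at least itself. -/
theorem bestGain_empty_pos [Nonempty V] : 0 < (Status.empty M).bestGain := by
  obtain ⟨v⟩ := ‹Nonempty V›
  refine lt_of_lt_of_le zero_lt_one (le_trans ?_ (expMarginal_le_bestGain _ v))
  unfold expMarginal
  rw [← sum_condProb (Status.empty M).real]
  refine Finset.sum_le_sum fun ψ _ => le_mul_of_one_le_right (condProb_nonneg _ _) ?_
  unfold marginal
  simp only [Status.empty, activeAfter_empty, Finset.empty_union, Finset.card_empty,
    Nat.cast_zero, sub_zero, Nat.one_le_cast]
  exact Finset.card_pos.mpr ⟨v, subset_activeAfter _ _ _ (Finset.mem_singleton_self v)⟩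

theorem regretRatio_empty [Nonempty V] (d : ℕ∞) : (Status.empty M).regretRatio d = 1 := by
  rw [isTerminated_empty.regretRatio_eq, div_self bestGain_empty_pos.ne']

end Status

/-! ### The decision tree and the three inequalities for one greedy step -/

namespace Policy

variable (π : Policy M) (d : ℕ∞)

theorem run_eq_iff {ψ₀ : Realization M} (h₀ : ψ₀.IsFull) (ψ : Realization M) (i : ℕ) :
    π.run d ψ i = π.run d ψ₀ i ↔ (π.run d ψ₀ i).real.Sub ψ :=
  ⟨fun h => h ▸ π.run_sub d ψ i, fun h => π.run_congr d h₀ h⟩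

/-- The status that the process reaches if the diffusion terminates after `i` repetitions. -/
noncomputable def finalRun (ψ : Realization M) (i : ℕ) : Status M := (π.run d ψ i).after ⊤ ψ

theorem finalRun_eq_iff {ψ₀ : Realization M} (h₀ : ψ₀.IsFull) (ψ : Realization M) (i : ℕ) :
    π.finalRun d ψ i = π.finalRun d ψ₀ i ↔ (π.finalRun d ψ₀ i).real.Sub ψ := by
  refine ⟨fun h => h ▸ Status.after_sub ⊤ (π.run_sub d ψ i), fun h => ?_⟩
  have h₁ : π.run d ψ i = π.run d ψ₀ i := π.run_congr d h₀ ((Status.sub_after _ _ _).trans h)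
  unfold finalRun
  rw [h₁]
  exact Status.after_congr h₀ h

theorem run_mem_treeLevel {ψ : Realization M} (hψ : ψ.IsFull) (hp : 0 < ψ.prob) (i : ℕ) :
    π.run d ψ i ∈ π.treeLevel d i := by
  induction i with
  | zero => exact Finset.mem_singleton_self _
  | succ i ih =>
    classical
    rw [treeLevel, Finset.mem_biUnion]
    refine ⟨_, ih, Status.mem_successors.mpr ⟨ψ, hψ, ?_, ?_, rfl⟩⟩
    · exact π.run_sub d ψ i
    · exact condProb_pos_of_sub (π.run_sub d ψ i) hp

theorem isTerminated_of_mem_treeLevel {U : Status M} {i : ℕ} (h : U ∈ π.treeLevel ⊤ i) :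
    U.IsTerminated := by
  cases i with
  | zero =>
    rw [treeLevel, Finset.mem_singleton] at h
    exact h ▸ Status.isTerminated_empty
  | succ i =>
    classical
    rw [treeLevel, Finset.mem_biUnion] at h
    obtain ⟨U₀, -, hU⟩ := h
    obtain ⟨ψ, hψ, -, -, rfl⟩ := Status.mem_successors.mp hU
    exact Status.isTerminated_after _ hψ

theorem regretRatio_le_treeRegret {k i : ℕ} (hi : i < k) {U : Status M}
    (hU : U ∈ π.treeLevel d i) : U.regretRatio ⊤ ≤ π.treeRegret k d := by
  have hfin : {a : ℝ | ∃ i < k, ∃ U ∈ π.treeLevel d i, a = U.regretRatio ⊤}.Finite := by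
    refine (((Finset.range k).biUnion fun i =>
      (π.treeLevel d i).image (Status.regretRatio ⊤)).finite_toSet).subset ?_
    rintro a ⟨i, hi, U, hU, rfl⟩
    simp only [Finset.coe_biUnion, Finset.mem_coe, Finset.mem_range, Set.mem_iUnion,
      Finset.mem_image]
    exact ⟨i, hi, U, hU, rfl⟩
  exact le_csSup hfin.bddAbove ⟨i, hi, U, hU, rfl⟩

/-- The initial status is terminated with positive best gain, so its ratio is exactly 1, and it
belongs to the tree since `k ≥ 1`. -/
theorem one_le_treeRegret [Nonempty V] {k : ℕ} (hk : 1 ≤ k) : 1 ≤ π.treeRegret k d := by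
  rw [← Status.regretRatio_empty (M := M) ⊤]
  exact π.regretRatio_le_treeRegret d hk (Finset.mem_singleton_self _)

/-- With `d = ∞` every status of the tree is terminated and is its own only successor; its ratio is
1, or 0 if no seed gains anything. -/
theorem treeRegret_top [Nonempty V] {k : ℕ} (hk : 1 ≤ k) : π.treeRegret k ⊤ = 1 := by
  refine le_antisymm (csSup_le ⟨_, 0, hk, _, Finset.mem_singleton_self _, rfl⟩ ?_)
    (π.one_le_treeRegret ⊤ hk)
  rintro a ⟨i, -, U, hU, rfl⟩
  rw [(π.isTerminated_of_mem_treeLevel hU).regretRatio_eq]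
  exact div_self_le_one _

theorem profit_eq_expect (k : ℕ) : π.profit k d =
    expect (fun ψ => ((activeAfter ⊤ (π.run d ψ k).active ψ).card : ℝ)) := rfl

theorem profit_nonneg (k : ℕ) : 0 ≤ π.profit k d :=
  expect_nonneg fun _ => Nat.cast_nonneg _

theorem profit_zero : π.profit 0 d = 0 := by
  simp [profit, run, Status.empty, activeAfter_empty]

/-- Given the status after `i` repetitions, the expected best gain after termination is the
numerator of its regret ratio. Level `i < k` of the tree bounds that ratio by α. -/
theorem expect_bestGain_finalRun_le [Nonempty V] {k i : ℕ} (hi : i < k) :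
    expect (fun ψ => (π.finalRun d ψ i).bestGain) ≤
      π.treeRegret k d * expect (fun ψ => (π.run d ψ i).bestGain) := by
  classical
  rw [← expect_const_mul]
  apply expect_le_of_fiber (fun ψ => π.run d ψ i)
  intro ψ₀ h₀ hp₀
  set U := π.run d ψ₀ i
  refine ⟨fun ψ => U.real.Sub ψ, fun ψ => π.run_eq_iff d h₀ ψ i, ?_⟩
  have hf : ∀ ψ, (if U.real.Sub ψ then (1 : ℝ) else 0) * (π.finalRun d ψ i).bestGain =
      (if U.real.Sub ψ then 1 else 0) * (U.after ⊤ ψ).bestGain := by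
    intro ψ
    by_cases h : U.real.Sub ψ
    · rw [if_pos h, finalRun, (π.run_eq_iff d h₀ ψ i).mpr h]
    · rw [if_neg h, zero_mul, zero_mul]
  have hg : ∀ ψ, (if U.real.Sub ψ then (1 : ℝ) else 0) *
      (π.treeRegret k d * (π.run d ψ i).bestGain) =
      (if U.real.Sub ψ then 1 else 0) * (π.treeRegret k d * U.bestGain) := by
    intro ψ
    by_cases h : U.real.Sub ψ
    · rw [if_pos h, (π.run_eq_iff d h₀ ψ i).mpr h]
    · rw [if_neg h, zero_mul, zero_mul]
  simp only [hf, hg]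
  rw [expect_ite_sub, expect_ite_sub, ← Finset.sum_mul, sum_condProb, one_mul,
    ← Status.sum_successors ⊤ U Status.bestGain]
  refine mul_le_mul_of_nonneg_left ((Status.sum_bestGain_le ⊤ U).trans ?_) (prob_nonneg _)
  exact mul_le_mul_of_nonneg_right
    (π.regretRatio_le_treeRegret d hi (π.run_mem_treeLevel d h₀ hp₀ i)) U.bestGain_nonneg

theorem IsGreedy.bestGain_le {π : Policy M} (hπ : π.IsGreedy) (U : Status M) :
    U.bestGain ≤ expMarginal ⊤ U.active {π U} U.real := by
  have : Nonempty V := ⟨π U⟩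
  exact ciSup_le fun v => hπ U v

/-- Given the current status, the greedy seed attains the best gain in expectation; the next `d`
rounds lose none of it, because the profit is counted after termination. -/
theorem IsGreedy.expect_bestGain_le {π : Policy M} (hπ : π.IsGreedy) (d : ℕ∞) (i : ℕ) :
    expect (fun ψ => (π.run d ψ i).bestGain) + π.profit i d ≤ π.profit (i + 1) d := by
  classical
  have h₁ : expect (fun ψ => (π.run d ψ i).bestGain) ≤
      expect (fun ψ => marginal ⊤ (π.run d ψ i).active {π (π.run d ψ i)} ψ) := by
    apply expect_le_of_fiber (fun ψ => π.run d ψ i)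
    intro ψ₀ h₀ hp₀
    set U := π.run d ψ₀ i
    refine ⟨fun ψ => U.real.Sub ψ, fun ψ => π.run_eq_iff d h₀ ψ i, ?_⟩
    have hf : ∀ ψ, (if U.real.Sub ψ then (1 : ℝ) else 0) * (π.run d ψ i).bestGain =
        (if U.real.Sub ψ then 1 else 0) * U.bestGain := by
      intro ψ
      by_cases h : U.real.Sub ψ
      · rw [if_pos h, (π.run_eq_iff d h₀ ψ i).mpr h]
      · rw [if_neg h, zero_mul, zero_mul]
    have hg : ∀ ψ, (if U.real.Sub ψ then (1 : ℝ) else 0) *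
        marginal ⊤ (π.run d ψ i).active {π (π.run d ψ i)} ψ =
        (if U.real.Sub ψ then 1 else 0) * marginal ⊤ U.active {π U} ψ := by
      intro ψ
      by_cases h : U.real.Sub ψ
      · rw [if_pos h, (π.run_eq_iff d h₀ ψ i).mpr h]
      · rw [if_neg h, zero_mul, zero_mul]
    simp only [hf, hg]
    rw [expect_ite_sub, expect_ite_sub, ← Finset.sum_mul, sum_condProb, one_mul]
    exact mul_le_mul_of_nonneg_left (hπ.bestGain_le U) (prob_nonneg _)
  refine (add_le_add_left h₁ _).trans ?_
  rw [profit_eq_expect, profit_eq_expect, ← expect_add]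
  apply expect_mono
  intro ψ _ _
  have : ((activeAfter ⊤ ((π.run d ψ i).active ∪ {π (π.run d ψ i)}) ψ).card : ℝ) ≤
      (activeAfter ⊤ (π.run d ψ (i + 1)).active ψ).card := by
    exact_mod_cast Finset.card_le_card (activeAfter_mono ψ (π.insert_run_subset d ψ i))
  unfold marginal
  linarith

/-- Adaptive submodularity: at a terminated status, the seed that another policy selects on its
own observations gains in expectation no more than the best seed. -/
theorem expect_freshReach_le (π' : Policy M) (i j : ℕ) :
    expect (fun ψ => freshReach ((π.finalRun d ψ i).active ∪ (π'.run d ψ j).active)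
      (π' (π'.run d ψ j)) ψ) ≤ expect (fun ψ => (π.finalRun d ψ i).bestGain) := by
  classical
  apply expect_le_of_fiber (fun ψ => (π.finalRun d ψ i, π'.run d ψ j))
  intro ψ₀ h₀ hp₀
  set Y := π.finalRun d ψ₀ i
  set W := π'.run d ψ₀ j
  have hYs : Y.real.Sub ψ₀ := Status.after_sub ⊤ (π.run_sub d ψ₀ i)
  have hYl : Y.IsLocal := (π.run_isLocal d ψ₀ i).after ⊤ ψ₀
  have hYt : Y.IsTerminated := Status.isTerminated_after _ h₀
  have hWl : W.IsLocal := π'.run_isLocal d ψ₀ j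
  set Z := Y.active ∪ W.active
  obtain ⟨P, hP⟩ : ∃ P : Realization M → Prop, ∀ ψ, P ψ ↔ Y.real.Sub ψ ∧ W.real.Sub ψ :=
    ⟨_, fun _ => Iff.rfl⟩
  have hiff : ∀ ψ, (π.finalRun d ψ i, π'.run d ψ j) = (Y, W) ↔ P ψ := fun ψ => by
    rw [hP, Prod.mk.injEq, π.finalRun_eq_iff d h₀, π'.run_eq_iff d h₀]
  refine ⟨P, hiff, ?_⟩
  have hf : ∀ ψ, (if P ψ then (1 : ℝ) else 0) *
      freshReach ((π.finalRun d ψ i).active ∪ (π'.run d ψ j).active) (π' (π'.run d ψ j)) ψ =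
      (if P ψ then 1 else 0) * freshReach Z (π' W) ψ := by
    intro ψ
    by_cases h : P ψ
    · obtain ⟨h₁, h₂⟩ := Prod.mk.inj ((hiff ψ).mpr h)
      rw [h₁, h₂]
    · rw [if_neg h, zero_mul, zero_mul]
  have hg : ∀ ψ, (if P ψ then (1 : ℝ) else 0) *
      (π.finalRun d ψ i).bestGain =
      Y.bestGain * (if P ψ then 1 else 0) := by
    intro ψ
    by_cases h : P ψ
    · rw [(Prod.mk.inj ((hiff ψ).mpr h)).1, mul_comm]
    · rw [if_neg h, zero_mul, mul_zero]
  simp only [hf, hg]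
  -- On the fibre `Z` and the seed `π' W` are fixed; both statuses are local, so `P` depends on
  -- tails in `Z` and is independent of the fresh reach.
  rw [expect_const_mul, expect_mul (Finset.univ.filter (fun e => e.1 ∈ Z)), mul_comm]
  · refine mul_le_mul_of_nonneg_right ?_ (expect_nonneg fun ψ => by split_ifs <;> norm_num)
    refine le_trans (expect_mono fun ψ _ _ => freshReach_anti Finset.subset_union_left _ ψ) ?_
    exact Status.expect_freshReach_le_bestGain hYt hYl (prob_pos_of_sub hYs hp₀) _
  · intro ψ ψ' hψ hψ' h
    have h' : ∀ e : V × V, e.1 ∈ Z → (e ∈ ψ.live ↔ e ∈ ψ'.live) := fun e he =>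
      h e (by simpa using he)
    have key : ∀ U : Status M, U.IsLocal → U.active ⊆ Z → (U.real.Sub ψ ↔ U.real.Sub ψ') :=
      fun U hl hs => ⟨fun hsub => hl.sub_of_agree hψ' hsub hs h',
        fun hsub => hl.sub_of_agree hψ hsub hs fun e he => (h' e he).symm⟩
    simp only [hP, key Y hYl Finset.subset_union_left, key W hWl Finset.subset_union_right]
  · intro ψ ψ' _ _ h
    exact freshReach_congr _ fun e he => h e (by simpa using he)

/-- Telescoping over the seeds of `π'`: each costs at most one best gain at the terminated status of
`π`, whatever `π'` has observed on its own. -/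
theorem expect_card_union_le (π' : Policy M) (i j : ℕ) :
    expect (fun ψ => ((activeAfter ⊤
      ((π.finalRun d ψ i).active ∪ (π'.run d ψ j).active) ψ).card : ℝ)) ≤
      π.profit i d + j * expect (fun ψ => (π.finalRun d ψ i).bestGain) := by
  induction j with
  | zero =>
    rw [Nat.cast_zero, zero_mul, add_zero, profit_eq_expect]
    apply expect_mono
    intro ψ _ _
    -- Waiting for termination does not enlarge the final active set.
    have : activeAfter ⊤ ((π.finalRun d ψ i).active ∪ (π'.run d ψ 0).active) ψ ⊆
        activeAfter ⊤ (π.run d ψ i).active ψ := by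
      apply activeAfter_subset _ (liveClosed_activeAfter _ _)
      refine Finset.union_subset ?_ (Finset.empty_subset _)
      exact Status.after_active_subset (π.run_sub d ψ i) (liveClosed_activeAfter _ _)
        (subset_activeAfter _ _ _)
    exact_mod_cast Finset.card_le_card this
  | succ j ih =>
    have hstep := π.expect_freshReach_le d π' i j
    have : expect (fun ψ => ((activeAfter ⊤
        ((π.finalRun d ψ i).active ∪ (π'.run d ψ (j + 1)).active) ψ).card : ℝ)) ≤
        expect (fun ψ => ((activeAfter ⊤
          ((π.finalRun d ψ i).active ∪ (π'.run d ψ j).active) ψ).card : ℝ) +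
          freshReach ((π.finalRun d ψ i).active ∪ (π'.run d ψ j).active)
            (π' (π'.run d ψ j)) ψ) := by
      apply expect_mono
      intro ψ _ _
      set Z := (π.finalRun d ψ i).active ∪ (π'.run d ψ j).active
      set v := π' (π'.run d ψ j)
      have hsub : activeAfter ⊤ ((π.finalRun d ψ i).active ∪ (π'.run d ψ (j + 1)).active) ψ ⊆
          activeAfter ⊤ (Z ∪ {v}) ψ := by
        apply activeAfter_subset _ (liveClosed_activeAfter _ _)
        have hZ := subset_activeAfter (⊤ : ℕ∞) (Z ∪ {v}) ψ
        refine Finset.union_subset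
          ((Finset.subset_union_left.trans Finset.subset_union_left).trans hZ) ?_
        refine Status.after_active_subset (U := (π'.run d ψ j).seed _) (π'.run_sub d ψ j)
          (liveClosed_activeAfter _ _) (Finset.Subset.trans ?_ hZ)
        exact Finset.insert_subset
          (Finset.mem_union_right _ (Finset.mem_singleton_self _))
          (Finset.subset_union_right.trans Finset.subset_union_left)
      have h₁ : ((activeAfter ⊤
          ((π.finalRun d ψ i).active ∪ (π'.run d ψ (j + 1)).active) ψ).card : ℝ) ≤
          (activeAfter ⊤ (Z ∪ {v}) ψ).card := by exact_mod_cast Finset.card_le_card hsub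
      have h₂ := marginal_le_freshReach Z v ψ
      unfold marginal at h₂
      linarith
    rw [expect_add] at this
    push_cast
    linarith

theorem profit_le (π' : Policy M) (i k : ℕ) :
    π'.profit k d ≤ π.profit i d + k * expect (fun ψ => (π.finalRun d ψ i).bestGain) := by
  refine le_trans ?_ (π.expect_card_union_le d π' i k)
  rw [profit_eq_expect]
  apply expect_mono
  intro ψ _ _
  exact_mod_cast Finset.card_le_card (activeAfter_mono ψ Finset.subset_union_right)

end Policy

end Adaptive

/-! ### The recursion for the gap, and the conclusion -/

/-- The growth of a sequence that closes the gap to `F` by a factor `1 - 1 / (k * α)` in each of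
`k` steps. -/
theorem one_sub_exp_mul_le_of_step {a : ℕ → ℝ} {F α : ℝ} {k : ℕ} (hk : 1 ≤ k) (hα : 1 ≤ α)
    (hF : 0 ≤ F) (h₀ : a 0 = 0) (h : ∀ i < k, F ≤ a i + k * (α * (a (i + 1) - a i))) :
    (1 - Real.exp (-1 / α)) * F ≤ a k := by
  have hk' : (1 : ℝ) ≤ k := by exact_mod_cast hk
  have hα₀ : 0 < α := by linarith
  have hk₀ : (0 : ℝ) < k := by linarith
  -- Needed twice: the contraction factor is nonnegative, and `(1 - x / k) ^ k ≤ exp (-x)` applies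
  -- with `x = 1 / α`.
  have hle : 1 / α ≤ k := ((div_le_one hα₀).mpr hα).trans hk'
  have hq : 0 ≤ 1 - 1 / α / k := sub_nonneg.mpr ((div_le_one hk₀).mpr hle)
  have key : ∀ i ≤ k, F - a i ≤ (1 - 1 / α / k) ^ i * F := by
    intro i
    induction i with
    | zero => simp [h₀]
    | succ i ih =>
      intro hi
      have h₁ := mul_le_mul_of_nonneg_left (ih (by omega)) hq
      have h₂ : (F - a i) / (k * α) ≤ a (i + 1) - a i := by
        rw [div_le_iff₀ (by positivity)]
        have := h i (by omega)
        linarith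
      have h₃ : (1 - 1 / α / k) * (F - a i) = (F - a i) - (F - a i) / (k * α) := by
        field_simp
      rw [pow_succ']
      linarith
  have h₁ := key k le_rfl
  have h₂ := mul_le_mul_of_nonneg_right (Real.one_sub_div_pow_le_exp_neg hle) hF
  rw [neg_div]
  linarith

namespace Policy

theorem IsGreedy.one_sub_exp_mul_profit_le {V : Type*} [Fintype V] [DecidableEq V]
    {M : ICModel V} {π : Policy M} (hπ : π.IsGreedy) (π' : Policy M) {k : ℕ} (hk : 1 ≤ k)
    (d : ℕ∞) : (1 - Real.exp (-1 / π.treeRegret k d)) * π'.profit k d ≤ π.profit k d := by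
  have : Nonempty V := ⟨π (Status.empty M)⟩
  have hα := π.one_le_treeRegret d hk
  refine one_sub_exp_mul_le_of_step (a := fun i => π.profit i d) hk hα (π'.profit_nonneg d k)
    (π.profit_zero d) fun i hi => (π.profit_le d π' i k).trans ?_
  have h₁ : expect (fun ψ => (π.run d ψ i).bestGain) ≤ π.profit (i + 1) d - π.profit i d :=
    le_sub_iff_add_le.mpr (hπ.expect_bestGain_le d i)
  have h₂ := (π.expect_bestGain_finalRun_le d hi).trans
    (mul_le_mul_of_nonneg_left h₁ (zero_le_one.trans hα))
  have h₃ := mul_le_mul_of_nonneg_left h₂ (Nat.cast_nonneg (α := ℝ) k)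
  linarith

end Policy

end AIM

theorem theorem1 {V : Type*} [Fintype V] [DecidableEq V] (M : AIM.ICModel V)
    (k : ℕ) (hk : 1 ≤ k) (d : ℕ∞) (hd : 1 ≤ d)
    (πg : AIM.Policy M) (hg : πg.IsGreedy) (π : AIM.Policy M) :
    πg.profit k d ≥ (1 - Real.exp (-1 / πg.treeRegret k d)) * π.profit k d ∧
    (d = ⊤ → πg.treeRegret k d = 1 ∧
      πg.profit k d ≥ (1 - 1 / Real.exp 1) * π.profit k d) := by
  have h := hg.one_sub_exp_mul_profit_le π hk d
  refine ⟨h, ?_⟩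
  rintro rfl
  have : Nonempty V := ⟨πg (AIM.Status.empty M)⟩
  have h₁ := πg.treeRegret_top hk
  refine ⟨h₁, ?_⟩
  rwa [h₁, div_one, Real.exp_neg, ← one_div] at h
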